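/- All Hilbert spaces are complex and all operators are bounded and linear. Let $T_1\in\mathcal B(H_1)$ and $T_2\in\mathcal B(H_2)$ be operators on Hilbert spaces $H_1,H_2$. For an $n\times n$ matrix $[p_{ij}]$ of polynomials in $\mathbb C[z]$, regard $[p_{ij}(T)]$, $T\in\mathcal B(H)$, as an operator on the Hilbert direct sum of $n$ copies of $H$. Say that $T_1$ is completely polynomially dominated by $T_2$ with bound $M>0$ if $$\big\|[p_{ij}(T_1)]_{i,j\le n}\big\|\le M\,\big\|[p_{ij}(T_2)]_{i,j\le n}\big\|$$ for all $n\ge 1$ and all $n\times n$ matrices $[p_{ij}]$ of polynomials; that it is so with finite bound if such an $M>0$ exists; and that $T_1$ is completely polynomially dominated by $T_2$ if this inequality always holds with $M=1$. Let $M_{cd}(T_1,T_2)$ be the infimum of the bounds $M>0$. A subspace $E$ of a Hilbert space $K$ is semi-invariant for $R\in\mathcal B(K)$ if $E=N_1\ominus N_2=N_1\cap N_2^{\perp}$ for closed $R$-invariant subspaces $N_2\subseteq N_1$ of $K$; the compression of $R$ to $E$ is $P_ER|_E\in\mathcal B(E)$, where $P_E$ is the orthogonal projection onto $E$. (1) $T_1$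 is completely polynomially dominated by $T_2$ if and only if there are a Hilbert space $K$, a unital $*$-homomorphism $\pi:\mathcal B(H_2)\to\mathcal B(K)$ and a semi-invariant subspace $E$ of $K$ for $\pi(T_2)$ such that $T_1$ is unitarily equivalent to the compression of $\pi(T_2)$ to $E$. (2) $T_1$ is completely polynomially dominated by $T_2$ with finite bound if and only if $T_1$ is similar to an operator that is completely polynomially dominated by $T_2$, that is, there is an invertible $L\in\mathcal B(H_1)$ such that $L^{-1}T_1L$ is completely polynomially dominated by $T_2$. (3) If $T_1$ is completely polynomially dominated by $T_2$ with finite bound, then $$\inf\big\{\|L^{-1}\|\,\|L\| : L\in\mathcal B(H_1)\text{ invertible},\ L^{-1}T_1L\text{ completely polynomially dominated by }T_2\big\}=M_{cd}(T_1,T_2),$$ and the displayed dominance inequality holds with $M=M_{cd}(T_1,T_2)$, so that this infimum is the least possible bound. -/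

import Mathlib

universe u v w

noncomputable section

namespace PolyDominated

/-- The operator on the Hilbert direct sum `H ⊕ ⋯ ⊕ H` (`n` copies, with the `ℓ²` norm) given by an
`n × n` matrix of bounded operators on `H`. -/
def blockOperator {H : Type*} [NormedAddCommGroup H] [InnerProductSpace ℂ H] {n : ℕ}
    (A : Matrix (Fin n) (Fin n) (H →L[ℂ] H)) :
    PiLp 2 (fun _ : Fin n => H) →L[ℂ] PiLp 2 (fun _ : Fin n => H) :=
  ((PiLp.continuousLinearEquiv 2 ℂ (fun _ : Fin n => H)).symm :
      (Fin n → H) →L[ℂ] PiLp 2 (fun _ : Fin n => H)) ∘L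
    ContinuousLinearMap.pi (fun i => ∑ j, A i j ∘L PiLp.proj 2 (fun _ : Fin n => H) j)

theorem blockOperator_apply {H : Type*} [NormedAddCommGroup H] [InnerProductSpace ℂ H] {n : ℕ}
    (A : Matrix (Fin n) (Fin n) (H →L[ℂ] H)) (x : PiLp 2 (fun _ : Fin n => H)) (i : Fin n) :
    blockOperator A x i = ∑ j, A i j (x j) := by
  simp [blockOperator]

/-- The matrix `[p_ij(T)]`, viewed as an operator on the direct sum of `n` copies of `H`. -/
def polyMatrix {H : Type*} [NormedAddCommGroup H] [InnerProductSpace ℂ H] {n : ℕ}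
    (p : Matrix (Fin n) (Fin n) (Polynomial ℂ)) (T : H →L[ℂ] H) :
    PiLp 2 (fun _ : Fin n => H) →L[ℂ] PiLp 2 (fun _ : Fin n => H) :=
  blockOperator (Matrix.of fun i j => Polynomial.aeval T (p i j))

section Dominance

variable {H₁ H₂ : Type*} [NormedAddCommGroup H₁] [InnerProductSpace ℂ H₁]
  [NormedAddCommGroup H₂] [InnerProductSpace ℂ H₂]

/-- `T₁` is completely polynomially dominated by `T₂`. -/
def CompletelyDominated (T₁ : H₁ →L[ℂ] H₁) (T₂ : H₂ →L[ℂ] H₂) : Prop :=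
  ∀ n : ℕ, 0 < n → ∀ p : Matrix (Fin n) (Fin n) (Polynomial ℂ),
    ‖polyMatrix p T₁‖ ≤ ‖polyMatrix p T₂‖

/-- The inequality defining complete polynomial dominance of `T₁` by `T₂` with bound `M`. -/
def CompletelyDominatedWithBound (M : ℝ) (T₁ : H₁ →L[ℂ] H₁) (T₂ : H₂ →L[ℂ] H₂) : Prop :=
  ∀ n : ℕ, 0 < n → ∀ p : Matrix (Fin n) (Fin n) (Polynomial ℂ),
    ‖polyMatrix p T₁‖ ≤ M * ‖polyMatrix p T₂‖

/-- `T₁` is completely polynomially dominated by `T₂` with finite bound. -/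
def CompletelyDominatedFiniteBound (T₁ : H₁ →L[ℂ] H₁) (T₂ : H₂ →L[ℂ] H₂) : Prop :=
  ∃ M : ℝ, 0 < M ∧ CompletelyDominatedWithBound M T₁ T₂

/-- The least bound of complete dominance of `T₁` by `T₂` (meaningful when a finite bound
exists). -/
def leastDominanceBound (T₁ : H₁ →L[ℂ] H₁) (T₂ : H₂ →L[ℂ] H₂) : ℝ :=
  sInf {M : ℝ | 0 < M ∧ CompletelyDominatedWithBound M T₁ T₂}

/-- The operators on `H₁` that are completely polynomially dominated by `T₂`. -/
def cDom (H₁ : Type*) [NormedAddCommGroup H₁] [InnerProductSpace ℂ H₁]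
    (T₂ : H₂ →L[ℂ] H₂) : Set (H₁ →L[ℂ] H₁) :=
  {T | CompletelyDominated T T₂}

end Dominance

section Similarity

variable {H : Type*} [NormedAddCommGroup H] [InnerProductSpace ℂ H]

/-- Similarity of two operators on `H`: `T₂ = L⁻¹ T₁ L` for an invertible bounded `L`. -/
def Similar (T₁ T₂ : H →L[ℂ] H) : Prop :=
  ∃ L : (H →L[ℂ] H)ˣ, T₂ = (↑L⁻¹ : H →L[ℂ] H) * T₁ * (L : H →L[ℂ] H)

/-- The similarity constant of `T` with respect to a class of operators (meaningful when `T` is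
similar to a member of the class). -/
def similarityConstant (T : H →L[ℂ] H) (𝒜 : Set (H →L[ℂ] H)) : ℝ :=
  sInf {c : ℝ | ∃ L : (H →L[ℂ] H)ˣ,
    (↑L⁻¹ : H →L[ℂ] H) * T * (L : H →L[ℂ] H) ∈ 𝒜 ∧
      c = ‖(↑L⁻¹ : H →L[ℂ] H)‖ * ‖(L : H →L[ℂ] H)‖}

end Similarity

section Compression

variable {K : Type*} [NormedAddCommGroup K] [InnerProductSpace ℂ K]

/-- `M` is semi-invariant for `R`: `M = N₁ ⊖ N₂` for closed `R`-invariant subspaces `N₂ ⊆ N₁`. -/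
def IsSemiInvariant (R : K →L[ℂ] K) (M : Submodule ℂ K) : Prop :=
  ∃ N₁ N₂ : Submodule ℂ K, IsClosed (N₁ : Set K) ∧ IsClosed (N₂ : Set K) ∧ N₂ ≤ N₁ ∧
    (∀ x ∈ N₁, R x ∈ N₁) ∧ (∀ x ∈ N₂, R x ∈ N₂) ∧ M = N₁ ⊓ N₂ᗮ

/-- The compression `P_M R | M` of `R` to `M`. -/
def compression (M : Submodule ℂ K) [M.HasOrthogonalProjection] (R : K →L[ℂ] K) : M →L[ℂ] M :=
  M.orthogonalProjectionOnto ∘L R ∘L M.subtypeL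

/-- Unitary equivalence of operators on possibly different Hilbert spaces. -/
def UnitarilyEquivalent {E F : Type*} [NormedAddCommGroup E] [InnerProductSpace ℂ E]
    [NormedAddCommGroup F] [InnerProductSpace ℂ F] (A : E →L[ℂ] E) (B : F →L[ℂ] F) : Prop :=
  ∃ U : E ≃ₗᵢ[ℂ] F, ∀ x, U (A x) = B (U x)

end Compression

end PolyDominated

end

/-!
A compression of `π(T₂)` to a semi-invariant subspace is dominated by `T₂`, because compression to
such a subspace is multiplicative on polynomials and because a `*`-homomorphism is completely
contractive (`completelyDominated_of_compression`). A similarity costs the factor `‖L⁻¹‖‖L‖`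
(`CompletelyDominated.withBound_of_similar`). Everything else follows from one converse: dominance
with bound `M` makes `T₁` similar to such a compression by a map that, like its inverse, has norm at
most `√M` (`CompletelyDominatedWithBound.exists_compression`). For `M = 1` this map is unitary, and
for general `M` polar decomposition (`exists_unitary_factor`) turns it into an invertible operator
on `H₁` with `‖L⁻¹‖‖L‖ ≤ M`.

The converse is the factorization theorem for completely bounded maps followed by Paulsen's
similarity argument, both reduced to the case at hand. Consider forms in indeterminate vectors `η_k`
and `ζ_h` of `H₂`, indexed by the elements of `H₁`, that combine `‖η_k‖²`, `‖ζ_h‖²` and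
`Re ⟪η_k, q(T₂) ζ_h⟫` for polynomials `q`. Dominance with bound `M` says that sending these
three to `M‖k‖²`, `M‖h‖²` and `Re ⟪k, q(T₁) h⟫` preserves positivity
(`CompletelyDominatedWithBound.form_nonneg`). By the M. Riesz extension theorem the assignment
extends to a positive functional `F` on all functions of the families `η`, `ζ` that are dominated by
forms (`exists_positiveFunctional_form`). This `F` is treated as an integral: the functions of
`(η, ζ)` with values in `H₂` and integrable squared norm have a completion on which `B(H₂)` acts
pointwise, and the evaluations `v k = η_k` and `w h = ζ_h` satisfy
`⟪v k, q(π T₂) w h⟫ = ⟪k, q(T₁) h⟫` (`CompletelyDominatedWithBound.exists_representation`).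

The maps `v` and `w` may fail to be linear, but this does no harm: on the closed span `N₁` of the
vectors `q(π T₂) w h` the vectors `v k` act as functionals that depend linearly on `k`, which yields
a bounded `S : N₁ → H₁` with `S (q(π T₂) w h) = q(T₁) h`. It intertwines `π T₂` and `T₁`, maps `w h`
to `h`, and is therefore an isomorphism from `N₁ ⊖ ker S` onto `H₁`
(`exists_semiInvariant_similar`).
-/

namespace PolyDominated

open Polynomial

/-! ### Operator matrices -/

section Blocks

variable {H E : Type*} [NormedAddCommGroup H] [InnerProductSpace ℂ H]
  [NormedAddCommGroup E] [InnerProductSpace ℂ E]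

theorem polyMatrix_apply {n : ℕ} (p : Matrix (Fin n) (Fin n) ℂ[X]) (T : H →L[ℂ] H)
    (x : PiLp 2 (fun _ : Fin n => H)) (i : Fin n) :
    polyMatrix p T x i = ∑ j, aeval T (p i j) (x j) := by
  simp [polyMatrix, blockOperator_apply]

theorem norm_toLp_map_le {n : ℕ} (X : H →L[ℂ] E) (x : PiLp 2 (fun _ : Fin n => H)) :
    ‖(WithLp.toLp 2 (fun i => X (x i)) : PiLp 2 (fun _ : Fin n => E))‖ ≤ ‖X‖ * ‖x‖ := by
  refine le_of_sq_le_sq ?_ (by positivity)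
  rw [mul_pow, PiLp.norm_sq_eq_of_L2, PiLp.norm_sq_eq_of_L2, Finset.mul_sum]
  refine Finset.sum_le_sum fun i _ => ?_
  rw [← mul_pow]
  exact pow_le_pow_left₀ (norm_nonneg _) (X.le_opNorm _) 2

/-- If every polynomial in `T` factors through the same polynomial in `S`, via fixed operators `X`
and `Y`, then so does every matrix of polynomials. This covers similarities, unitary equivalences
and compressions to semi-invariant subspaces. -/
theorem norm_polyMatrix_le_of_factor {T : H →L[ℂ] H} {S : E →L[ℂ] E} (X : H →L[ℂ] E)
    (Y : E →L[ℂ] H) (h : ∀ q : ℂ[X], ∀ x, aeval T q x = Y (aeval S q (X x))) {n : ℕ}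
    (p : Matrix (Fin n) (Fin n) ℂ[X]) :
    ‖polyMatrix p T‖ ≤ ‖Y‖ * ‖X‖ * ‖polyMatrix p S‖ := by
  refine ContinuousLinearMap.opNorm_le_bound _ (by positivity) fun x => ?_
  have key : polyMatrix p T x = WithLp.toLp 2 (fun i =>
      Y (polyMatrix p S (WithLp.toLp 2 (fun j => X (x j))) i)) := by
    ext i
    simp [polyMatrix_apply, h, map_sum]
  rw [key]
  calc _ ≤ ‖Y‖ * ‖polyMatrix p S (WithLp.toLp 2 (fun j => X (x j)))‖ := norm_toLp_map_le Y _
    _ ≤ ‖Y‖ * (‖polyMatrix p S‖ * (‖X‖ * ‖x‖)) := by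
      gcongr
      exact (ContinuousLinearMap.le_opNorm _ _).trans (by gcongr; exact norm_toLp_map_le X x)
    _ = _ := by ring

theorem aeval_intertwine {T : H →L[ℂ] H} {S : E →L[ℂ] E} (X : H →L[ℂ] E)
    (h : ∀ x, X (T x) = S (X x)) (q : ℂ[X]) (x : H) : X (aeval T q x) = aeval S q (X x) := by
  induction q using Polynomial.induction_on' generalizing x with
  | add p q hp hq => simp [hp, hq]
  | monomial n a =>
    have : Function.Semiconj X T S := h
    simp [aeval_monomial, Algebra.algebraMap_eq_smul_one, (this.iterate_right n).eq]

theorem norm_polyMatrix_le_of_similar {T : H →L[ℂ] H} (L : (H →L[ℂ] H)ˣ) {n : ℕ}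
    (p : Matrix (Fin n) (Fin n) ℂ[X]) :
    ‖polyMatrix p T‖ ≤ ‖(↑L⁻¹ : H →L[ℂ] H)‖ * ‖(L : H →L[ℂ] H)‖ *
      ‖polyMatrix p ((↑L⁻¹ : H →L[ℂ] H) * T * (L : H →L[ℂ] H))‖ := by
  have hL : ∀ x, (L : H →L[ℂ] H) ((↑L⁻¹ : H →L[ℂ] H) x) = x := fun x => by
    rw [← mul_apply_eq_comp, Units.mul_inv, one_apply_eq_self]
  refine (norm_polyMatrix_le_of_factor (S := (↑L⁻¹ : H →L[ℂ] H) * T * (L : H →L[ℂ] H))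
    (↑L⁻¹) ↑L (fun q x => ?_) p).trans_eq (by ring)
  rw [aeval_intertwine (T := (↑L⁻¹ : H →L[ℂ] H) * T * (L : H →L[ℂ] H)) (S := T) _ (by simp [hL]),
    hL]

theorem UnitarilyEquivalent.norm_polyMatrix_le {A : H →L[ℂ] H} {B : E →L[ℂ] E}
    (h : UnitarilyEquivalent A B) {n : ℕ} (p : Matrix (Fin n) (Fin n) ℂ[X]) :
    ‖polyMatrix p A‖ ≤ ‖polyMatrix p B‖ := by
  obtain ⟨U, hU⟩ := h
  have h1 : ‖(U.toContinuousLinearEquiv : H →L[ℂ] E)‖ ≤ 1 :=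
    ContinuousLinearMap.opNorm_le_bound _ zero_le_one (by simp)
  have h2 : ‖(U.symm.toContinuousLinearEquiv : E →L[ℂ] H)‖ ≤ 1 :=
    ContinuousLinearMap.opNorm_le_bound _ zero_le_one (by simp)
  refine (norm_polyMatrix_le_of_factor (S := B) (U.toContinuousLinearEquiv : H →L[ℂ] E)
    (U.symm.toContinuousLinearEquiv : E →L[ℂ] H) (fun q x => ?_) p).trans ?_
  · rw [← aeval_intertwine (T := A) (S := B) (U.toContinuousLinearEquiv : H →L[ℂ] E)
      (by simpa using hU)]
    simp
  · exact mul_le_of_le_one_left (norm_nonneg (polyMatrix p B))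
      (mul_le_one₀ h2 (norm_nonneg _) h1)

theorem UnitarilyEquivalent.symm {A : H →L[ℂ] H} {B : E →L[ℂ] E}
    (h : UnitarilyEquivalent A B) : UnitarilyEquivalent B A := by
  obtain ⟨U, hU⟩ := h
  exact ⟨U.symm, fun x => by rw [LinearIsometryEquiv.symm_apply_eq, hU]; simp⟩

/-- The `(i, j)` entry of an operator on the direct sum of `n` copies of `H`. -/
noncomputable def blockEntry {n : ℕ}
    (B : PiLp 2 (fun _ : Fin n => H) →L[ℂ] PiLp 2 (fun _ : Fin n => H)) (i j : Fin n) :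
    H →L[ℂ] H :=
  PiLp.proj 2 (fun _ : Fin n => H) i ∘L B ∘L
    ((PiLp.continuousLinearEquiv 2 ℂ (fun _ : Fin n => H)).symm :
      (Fin n → H) →L[ℂ] PiLp 2 (fun _ : Fin n => H)) ∘L ContinuousLinearMap.single ℂ (fun _ => H) j

theorem blockEntry_apply {n : ℕ}
    (B : PiLp 2 (fun _ : Fin n => H) →L[ℂ] PiLp 2 (fun _ : Fin n => H)) (i j : Fin n) (x : H) :
    blockEntry B i j x = B (WithLp.toLp 2 (Pi.single j x)) i := by
  simp [blockEntry]

theorem sum_blockEntry_apply {n : ℕ}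
    (B : PiLp 2 (fun _ : Fin n => H) →L[ℂ] PiLp 2 (fun _ : Fin n => H))
    (x : PiLp 2 (fun _ : Fin n => H)) (i : Fin n) : ∑ j, blockEntry B i j (x j) = B x i := by
  have hx : x = ∑ j, WithLp.toLp 2 (Pi.single j (x j)) := by
    ext k
    simp
  conv_rhs => rw [hx]
  simp only [blockEntry_apply, map_sum, WithLp.ofLp_sum, Finset.sum_apply]

theorem blockEntry_blockOperator {n : ℕ} (A : Matrix (Fin n) (Fin n) (H →L[ℂ] H)) (i j : Fin n) :
    blockEntry (blockOperator A) i j = A i j := by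
  ext x
  rw [blockEntry_apply, blockOperator_apply, Finset.sum_eq_single j]
  · simp
  · intro k _ hk; simp [hk]
  · simp

variable [CompleteSpace H] [CompleteSpace E]

omit [CompleteSpace H] in
theorem blockEntry_mul {n : ℕ}
    (B C : PiLp 2 (fun _ : Fin n => H) →L[ℂ] PiLp 2 (fun _ : Fin n => H)) (i j : Fin n) :
    blockEntry (B * C) i j = ∑ k, blockEntry B i k * blockEntry C k j := by
  ext x
  simp only [sum_apply, mul_apply_eq_comp]
  simp_rw [blockEntry_apply C]
  rw [sum_blockEntry_apply, blockEntry_apply, mul_apply_eq_comp]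

theorem blockEntry_star {n : ℕ}
    (B : PiLp 2 (fun _ : Fin n => H) →L[ℂ] PiLp 2 (fun _ : Fin n => H)) (i j : Fin n) :
    blockEntry (star B) i j = star (blockEntry B j i) := by
  rw [ContinuousLinearMap.star_eq_adjoint, ContinuousLinearMap.star_eq_adjoint,
    ContinuousLinearMap.eq_adjoint_iff]
  intro x y
  have h := ContinuousLinearMap.adjoint_inner_left B (WithLp.toLp 2 (Pi.single i y))
    (WithLp.toLp 2 (Pi.single j x))
  rw [PiLp.inner_apply, PiLp.inner_apply, Finset.sum_eq_single i, Finset.sum_eq_single j] at h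
  · simpa [blockEntry_apply] using h
  all_goals simp +contextual

/-- The entrywise application of a `*`-homomorphism `B(H) → B(E)`, as a `*`-homomorphism between
the operators on the `n`-fold direct sums. -/
noncomputable def amplification (n : ℕ) (π : (H →L[ℂ] H) →⋆ₐ[ℂ] (E →L[ℂ] E)) :
    (PiLp 2 (fun _ : Fin n => H) →L[ℂ] PiLp 2 (fun _ : Fin n => H)) →⋆ₙₐ[ℂ]
      (PiLp 2 (fun _ : Fin n => E) →L[ℂ] PiLp 2 (fun _ : Fin n => E)) where
  toFun B := blockOperator (Matrix.of fun i j => π (blockEntry B i j))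
  map_smul' c B := by
    ext x i
    simp [blockOperator_apply, blockEntry, Finset.smul_sum]
  map_zero' := by
    ext x i
    simp [blockOperator_apply, blockEntry]
  map_add' B C := by
    ext x i
    simp [blockOperator_apply, blockEntry, Finset.sum_add_distrib]
  map_mul' B C := by
    ext x i
    simp only [mul_apply_eq_comp, blockOperator_apply, Matrix.of_apply, blockEntry_mul,
      map_sum, map_mul, sum_apply]
    exact Finset.sum_comm
  map_star' B := by
    refine (ContinuousLinearMap.eq_adjoint_iff _ _).mpr fun x y => ?_
    simp only [blockEntry_star, map_star]
    simp only [PiLp.inner_apply, blockOperator_apply, Matrix.of_apply, sum_inner, inner_sum,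
      ContinuousLinearMap.star_eq_adjoint,
      ContinuousLinearMap.adjoint_inner_left]
    exact Finset.sum_comm

/-- A `*`-homomorphism is completely contractive. -/
theorem norm_polyMatrix_map_le (π : (H →L[ℂ] H) →⋆ₐ[ℂ] (E →L[ℂ] E)) (T : H →L[ℂ] H) {n : ℕ}
    (p : Matrix (Fin n) (Fin n) ℂ[X]) : ‖polyMatrix p (π T)‖ ≤ ‖polyMatrix p T‖ := by
  have h : polyMatrix p (π T) = amplification n π (polyMatrix p T) := by
    change _ = blockOperator _
    simp only [polyMatrix, blockEntry_blockOperator, Matrix.of_apply]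
    congr! 4 with i j
    exact Polynomial.aeval_algHom_apply π.toAlgHom T (p i j)
  rw [h]
  exact NonUnitalStarAlgHom.norm_apply_le _ _

end Blocks

/-! ### Compressions to semi-invariant subspaces -/

section Compression

variable {K : Type*} [NormedAddCommGroup K] [InnerProductSpace ℂ K]

/-- On `N₁`, the projection to `N₁ ⊖ N₂` intertwines `R` with its compression, because the part of
a vector that it deletes lies in the invariant subspace `N₂`. -/
theorem orthogonalProjectionOnto_comp [CompleteSpace K] {R : K →L[ℂ] K} {N₁ N₂ : Submodule ℂ K}
    (h₂ : IsClosed (N₂ : Set K)) (hle : N₂ ≤ N₁) (hN₂ : ∀ x ∈ N₂, R x ∈ N₂)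
    [(N₁ ⊓ N₂ᗮ).HasOrthogonalProjection] {x : K} (hx : x ∈ N₁) :
    (N₁ ⊓ N₂ᗮ).orthogonalProjectionOnto (R x) =
      compression (N₁ ⊓ N₂ᗮ) R ((N₁ ⊓ N₂ᗮ).orthogonalProjectionOnto x) := by
  have : CompleteSpace N₂ := h₂.completeSpace_coe
  have hP : ∀ y ∈ N₁, (((N₁ ⊓ N₂ᗮ).orthogonalProjectionOnto y : K)) = y - N₂.starProjection y := by
    intro y hy
    have hy' : y - N₂.starProjection y ∈ N₁ ⊓ N₂ᗮ :=
      ⟨N₁.sub_mem hy (hle (N₂.starProjection_apply_mem y)), N₂.sub_starProjection_mem_orthogonal y⟩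
    rw [← Submodule.starProjection_apply]
    refine (Submodule.eq_starProjection_of_mem_orthogonal hy' ?_)
    rw [sub_sub_cancel, Submodule.mem_orthogonal]
    exact fun u hu => Submodule.inner_left_of_mem_orthogonal (N₂.starProjection_apply_mem y) hu.2
  have h0 : ∀ z ∈ N₂, (N₁ ⊓ N₂ᗮ).orthogonalProjectionOnto z = 0 := by
    intro z hz
    rw [Submodule.orthogonalProjectionOnto_eq_zero_iff, Submodule.mem_orthogonal]
    exact fun u hu => Submodule.inner_left_of_mem_orthogonal hz hu.2
  simp only [compression, ContinuousLinearMap.comp_apply, Submodule.subtypeL_apply, hP x hx,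
    map_sub]
  rw [h0 _ (hN₂ _ (N₂.starProjection_apply_mem x)), sub_zero]

theorem aeval_compression [CompleteSpace K] {R : K →L[ℂ] K} {N₁ N₂ : Submodule ℂ K}
    (h₂ : IsClosed (N₂ : Set K)) (hle : N₂ ≤ N₁) (hN₁ : ∀ x ∈ N₁, R x ∈ N₁)
    (hN₂ : ∀ x ∈ N₂, R x ∈ N₂)
    [(N₁ ⊓ N₂ᗮ).HasOrthogonalProjection] (q : ℂ[X]) {x : K} (hx : x ∈ N₁) :
    aeval (compression (N₁ ⊓ N₂ᗮ) R) q ((N₁ ⊓ N₂ᗮ).orthogonalProjectionOnto x) =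
      (N₁ ⊓ N₂ᗮ).orthogonalProjectionOnto (aeval R q x) := by
  induction q using Polynomial.induction_on' with
  | add p q hp hq => simp [hp, hq]
  | monomial n a =>
    have : ((compression (N₁ ⊓ N₂ᗮ) R) ^ n) ((N₁ ⊓ N₂ᗮ).orthogonalProjectionOnto x) =
        (N₁ ⊓ N₂ᗮ).orthogonalProjectionOnto ((R ^ n) x) ∧ (R ^ n) x ∈ N₁ := by
      induction n with
      | zero => simpa using hx
      | succ n ih =>
        rw [pow_succ', pow_succ', mul_apply_eq_comp, mul_apply_eq_comp,
          ih.1, orthogonalProjectionOnto_comp h₂ hle hN₂ ih.2]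
        exact ⟨rfl, hN₁ _ ih.2⟩
    simp [aeval_monomial, Algebra.algebraMap_eq_smul_one, this]

theorem norm_polyMatrix_compression_le [CompleteSpace K] {R : K →L[ℂ] K} {E : Submodule ℂ K}
    [E.HasOrthogonalProjection] (hE : IsSemiInvariant R E) {n : ℕ}
    (p : Matrix (Fin n) (Fin n) ℂ[X]) : ‖polyMatrix p (compression E R)‖ ≤ ‖polyMatrix p R‖ := by
  obtain ⟨N₁, N₂, -, h₂, hle, hN₁, hN₂, rfl⟩ := hE
  refine (norm_polyMatrix_le_of_factor (S := R) (N₁ ⊓ N₂ᗮ).subtypeL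
    (N₁ ⊓ N₂ᗮ).orthogonalProjectionOnto (fun q x => ?_) p).trans ?_
  · rw [← aeval_compression h₂ hle hN₁ hN₂ q (x := (N₁ ⊓ N₂ᗮ).subtypeL x) x.2.1]
    simp
  · refine mul_le_of_le_one_left (norm_nonneg _) (mul_le_one₀ ?_ (norm_nonneg _) ?_)
    · exact Submodule.orthogonalProjectionOnto_norm_le _
    · exact Submodule.norm_subtypeL_le _

theorem completelyDominated_of_compression {H₁ H₂ : Type*} [NormedAddCommGroup H₁]
    [InnerProductSpace ℂ H₁] [NormedAddCommGroup H₂] [InnerProductSpace ℂ H₂] [CompleteSpace H₂]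
    [CompleteSpace K] {T₁ : H₁ →L[ℂ] H₁} {T₂ : H₂ →L[ℂ] H₂}
    (π : (H₂ →L[ℂ] H₂) →⋆ₐ[ℂ] (K →L[ℂ] K)) (E : Submodule ℂ K) [E.HasOrthogonalProjection]
    (hE : IsSemiInvariant (π T₂) E) (hU : UnitarilyEquivalent T₁ (compression E (π T₂))) :
    CompletelyDominated T₁ T₂ := fun _ _ p =>
  ((hU.norm_polyMatrix_le p).trans (norm_polyMatrix_compression_le hE p)).trans
    (norm_polyMatrix_map_le π T₂ p)

end Compression

/-! ### Positivity of forms with polynomial off-diagonal part -/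

section Positivity

variable {H₁ H₂ : Type*} [NormedAddCommGroup H₁] [InnerProductSpace ℂ H₁]
  [NormedAddCommGroup H₂] [InnerProductSpace ℂ H₂] {T₁ : H₁ →L[ℂ] H₁} {T₂ : H₂ →L[ℂ] H₂} {M : ℝ}

theorem polyMatrix_smul_apply {H : Type*} [NormedAddCommGroup H] [InnerProductSpace ℂ H]
    (T : H →L[ℂ] H) {n : ℕ} (a b : Fin n → ℝ) (q : Matrix (Fin n) (Fin n) ℂ[X])
    (x : PiLp 2 (fun _ : Fin n => H)) (i : Fin n) :
    polyMatrix (Matrix.of fun i j => ((a i * b j : ℝ) : ℂ) • q i j) T x i =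
      (a i : ℂ) • ∑ j, aeval T (q i j) ((b j : ℂ) • x j) := by
  simp [polyMatrix_apply, Finset.smul_sum, mul_smul, -Complex.coe_smul]

/-- The case of positive weights `a i ^ 2` and `b j ^ 2`: dividing row `i` by `a i` and column `j`
by `b j` turns positivity of the form into contractivity of a matrix of polynomials. -/
theorem CompletelyDominatedWithBound.form_nonneg_of_pos (hM : 0 ≤ M)
    (h : CompletelyDominatedWithBound M T₁ T₂) {n : ℕ} (hn : 0 < n)
    {a b : Fin n → ℝ} (ha : ∀ i, 0 < a i) (hb : ∀ i, 0 < b i) (q : Matrix (Fin n) (Fin n) ℂ[X])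
    (hpos : ∀ η ζ : Fin n → H₂, 0 ≤ ∑ i, a i ^ 2 * ‖η i‖ ^ 2 + ∑ j, b j ^ 2 * ‖ζ j‖ ^ 2 +
      2 * (∑ i, ∑ j, inner ℂ (η i) (aeval T₂ (q i j) (ζ j))).re) (x y : Fin n → H₁) :
    0 ≤ M * (∑ i, a i ^ 2 * ‖x i‖ ^ 2 + ∑ j, b j ^ 2 * ‖y j‖ ^ 2) +
      2 * (∑ i, ∑ j, inner ℂ (x i) (aeval T₁ (q i j) (y j))).re := by
  set p : Matrix (Fin n) (Fin n) ℂ[X] :=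
    Matrix.of fun i j => (((a i)⁻¹ * (b j)⁻¹ : ℝ) : ℂ) • q i j with hp
  have h₂ : ‖polyMatrix p T₂‖ ≤ 1 := by
    refine ContinuousLinearMap.opNorm_le_bound _ zero_le_one fun z => ?_
    rw [one_mul]
    refine le_of_sq_le_sq ?_ (norm_nonneg _)
    -- The form is tested at the vectors that make its off-diagonal part equal to `-‖A z‖²`.
    have := hpos (fun i => -(((a i)⁻¹ : ℝ) : ℂ) • polyMatrix p T₂ z i)
      (fun j => (((b j)⁻¹ : ℝ) : ℂ) • z j)
    have e1 : ∑ i, a i ^ 2 * ‖-(((a i)⁻¹ : ℝ) : ℂ) • polyMatrix p T₂ z i‖ ^ 2 =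
        ‖polyMatrix p T₂ z‖ ^ 2 := by
      rw [PiLp.norm_sq_eq_of_L2]
      refine Finset.sum_congr rfl fun i _ => ?_
      have := (ha i).ne'
      rw [norm_smul, norm_neg, Complex.norm_real, mul_pow, Real.norm_eq_abs, sq_abs]
      field_simp
    have e2 : ∑ j, b j ^ 2 * ‖(((b j)⁻¹ : ℝ) : ℂ) • z j‖ ^ 2 = ‖z‖ ^ 2 := by
      rw [PiLp.norm_sq_eq_of_L2]
      refine Finset.sum_congr rfl fun i _ => ?_
      have := (hb i).ne'
      rw [norm_smul, Complex.norm_real, mul_pow, Real.norm_eq_abs, sq_abs]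
      field_simp
    have e3 : ∑ i, ∑ j, inner ℂ (-(((a i)⁻¹ : ℝ) : ℂ) • polyMatrix p T₂ z i)
        (aeval T₂ (q i j) ((((b j)⁻¹ : ℝ) : ℂ) • z j)) = -((‖polyMatrix p T₂ z‖ ^ 2 : ℝ) : ℂ) := by
      rw [PiLp.norm_sq_eq_of_L2, Complex.ofReal_sum, ← Finset.sum_neg_distrib]
      refine Finset.sum_congr rfl fun i _ => ?_
      rw [← inner_sum, neg_smul, inner_neg_left, inner_smul_left, Complex.conj_ofReal,
        ← inner_smul_right, ← polyMatrix_smul_apply T₂ (fun i => (a i)⁻¹) (fun i => (b i)⁻¹),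
        inner_self_eq_norm_sq_to_K]
      simp
    rw [e1, e2, e3, Complex.neg_re, Complex.ofReal_re] at this
    linarith
  have h₁ : ‖polyMatrix p T₁‖ ≤ M :=
    (h n hn p).trans (mul_le_of_le_one_right hM h₂)
  set X : PiLp 2 (fun _ : Fin n => H₁) := WithLp.toLp 2 fun i => (a i : ℂ) • x i with hX
  set Y : PiLp 2 (fun _ : Fin n => H₁) := WithLp.toLp 2 fun i => (b i : ℂ) • y i with hY
  have hXn : ‖X‖ ^ 2 = ∑ i, a i ^ 2 * ‖x i‖ ^ 2 := by
    rw [PiLp.norm_sq_eq_of_L2]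
    simp [hX, norm_smul, mul_pow]
  have hYn : ‖Y‖ ^ 2 = ∑ i, b i ^ 2 * ‖y i‖ ^ 2 := by
    rw [PiLp.norm_sq_eq_of_L2]
    simp [hY, norm_smul, mul_pow]
  have hXY : (∑ i, ∑ j, inner ℂ (x i) (aeval T₁ (q i j) (y j))) =
      inner ℂ X (polyMatrix p T₁ Y) := by
    rw [PiLp.inner_apply]
    refine Finset.sum_congr rfl fun i _ => ?_
    rw [hp, polyMatrix_smul_apply]
    have := (ha i).ne'
    have : ∀ j, b j ≠ 0 := fun j => (hb j).ne'
    simp [X, Y, inner_smul_left, inner_smul_right, smul_smul, inner_sum, -Complex.coe_smul, *]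
    rw [← Finset.mul_sum, inv_mul_cancel_left₀ (by exact_mod_cast (ha i).ne')]
  rw [hXY, ← hXn, ← hYn]
  have h3 : ‖inner ℂ X (polyMatrix p T₁ Y)‖ ≤ ‖X‖ * (M * ‖Y‖) :=
    (norm_inner_le_norm _ _).trans (by
      gcongr; exact (ContinuousLinearMap.le_opNorm _ _).trans (by gcongr))
  have h4 := (abs_le.1 (Complex.abs_re_le_norm (inner ℂ X (polyMatrix p T₁ Y)))).1
  nlinarith [mul_nonneg hM (sq_nonneg (‖X‖ - ‖Y‖))]

/-- Complete dominance with bound `M`, read as an order-theoretic statement: a form in the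
indeterminate vectors `η` and `ζ` that has scalar diagonal blocks and polynomials in `T₂` off the
diagonal, and that is positive, stays positive when `T₂` is replaced by `T₁` and the diagonal is
multiplied by `M`. -/
theorem CompletelyDominatedWithBound.form_nonneg [Nontrivial H₂] (hM : 0 ≤ M)
    (h : CompletelyDominatedWithBound M T₁ T₂) {n : ℕ} (hn : 0 < n)
    (l m : Fin n → ℝ) (q : Matrix (Fin n) (Fin n) ℂ[X])
    (hpos : ∀ η ζ : Fin n → H₂, 0 ≤ ∑ i, l i * ‖η i‖ ^ 2 + ∑ j, m j * ‖ζ j‖ ^ 2 +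
      2 * (∑ i, ∑ j, inner ℂ (η i) (aeval T₂ (q i j) (ζ j))).re) (x y : Fin n → H₁) :
    0 ≤ M * (∑ i, l i * ‖x i‖ ^ 2 + ∑ j, m j * ‖y j‖ ^ 2) +
      2 * (∑ i, ∑ j, inner ℂ (x i) (aeval T₁ (q i j) (y j))).re := by
  obtain ⟨v, hv⟩ := exists_norm_eq H₂ zero_le_one
  have hl : ∀ i, 0 ≤ l i := fun i => by
    simpa [Pi.single_apply, apply_ite, hv, ite_pow] using hpos (Pi.single i v) 0
  have hm : ∀ i, 0 ≤ m i := fun i => by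
    simpa [Pi.single_apply, apply_ite, hv, ite_pow] using hpos 0 (Pi.single i v)
  -- The weights are made strictly positive, in order to divide by their square roots.
  have key : ∀ ε > 0, 0 ≤ M * (∑ i, l i * ‖x i‖ ^ 2 + ∑ j, m j * ‖y j‖ ^ 2) +
      2 * (∑ i, ∑ j, inner ℂ (x i) (aeval T₁ (q i j) (y j))).re +
        ε * (M * (∑ i, ‖x i‖ ^ 2 + ∑ j, ‖y j‖ ^ 2)) := by
    intro ε hε
    have hl' : ∀ i, 0 < l i + ε := fun i => by linarith [hl i]
    have hm' : ∀ i, 0 < m i + ε := fun i => by linarith [hm i]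
    have := h.form_nonneg_of_pos hM hn (a := fun i => √(l i + ε)) (b := fun i => √(m i + ε))
      (fun i => Real.sqrt_pos.2 (hl' i)) (fun i => Real.sqrt_pos.2 (hm' i)) q ?_ x y
    · simp only [Real.sq_sqrt (hl' _).le, Real.sq_sqrt (hm' _).le, add_mul,
        Finset.sum_add_distrib, ← Finset.mul_sum] at this
      linarith
    · intro η ζ
      simp only [Real.sq_sqrt (hl' _).le, Real.sq_sqrt (hm' _).le, add_mul,
        Finset.sum_add_distrib, ← Finset.mul_sum]
      have h1 : 0 ≤ ε * ∑ i, ‖η i‖ ^ 2 := by positivity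
      have h2 : 0 ≤ ε * ∑ i, ‖ζ i‖ ^ 2 := by positivity
      linarith [hpos η ζ]
  set A := M * (∑ i, l i * ‖x i‖ ^ 2 + ∑ j, m j * ‖y j‖ ^ 2) +
      2 * (∑ i, ∑ j, inner ℂ (x i) (aeval T₁ (q i j) (y j))).re
  set B := M * (∑ i, ‖x i‖ ^ 2 + ∑ j, ‖y j‖ ^ 2)
  have hB : 0 ≤ B := by positivity
  refine le_of_forall_pos_le_add fun ε hε => (key (ε / (B + 1)) (by positivity)).trans ?_
  have : ε / (B + 1) * B ≤ ε := by
    rw [div_mul_eq_mul_div, div_le_iff₀ (by positivity)]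
    nlinarith
  linarith

end Positivity

/-! ### Square-integrable functions for a positive functional -/

/-- A finitely additive analogue of an integral on a set `Ω`: a linear functional on all real
functions on `Ω` that is positive on a solid subspace `domain` of them. Off the domain its values
carry no information. -/
structure PositiveFunctional (Ω : Type*) where
  /-- The functions that count as integrable. -/
  domain : Submodule ℝ (Ω → ℝ)
  /-- The integral. -/
  toFun : (Ω → ℝ) →ₗ[ℝ] ℝ
  solid : ∀ {f g : Ω → ℝ}, g ∈ domain → (∀ ω, |f ω| ≤ g ω) → f ∈ domain
  nonneg : ∀ {f : Ω → ℝ}, f ∈ domain → (∀ ω, 0 ≤ f ω) → 0 ≤ toFun f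

namespace PositiveFunctional

variable {Ω : Type*} (F : PositiveFunctional Ω) (H : Type*) [NormedAddCommGroup H]
  [InnerProductSpace ℂ H]

/-- The functions `Ω → H` whose squared norm is integrable. -/
def PreL2 : Type _ :=
  ({ carrier := {f | (fun ω => ‖f ω‖ ^ 2) ∈ F.domain}
     zero_mem' := by
      have : (fun ω : Ω => ‖(0 : Ω → H) ω‖ ^ 2) = 0 := by ext; simp
      rw [Set.mem_ofPred_eq, this]
      exact F.domain.zero_mem
     add_mem' := fun {f g} hf hg => F.solid
      (F.domain.smul_mem 2 (F.domain.add_mem hf hg)) fun ω => by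
        rw [abs_of_nonneg (by positivity)]
        have := norm_add_le (f ω) (g ω)
        simp only [Pi.add_apply, Pi.smul_apply, smul_eq_mul]
        nlinarith [sq_nonneg (‖f ω‖ - ‖g ω‖), norm_nonneg (f ω + g ω)]
     smul_mem' := fun c f hf => by
      have : (fun ω => ‖(c • f) ω‖ ^ 2) = (‖c‖ ^ 2) • fun ω => ‖f ω‖ ^ 2 := by
        ext ω; simp [norm_smul, mul_pow]
      rw [Set.mem_ofPred_eq, this]
      exact F.domain.smul_mem _ hf } : Submodule ℂ (Ω → H))

variable {H}

namespace PreL2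

noncomputable instance : AddCommGroup (F.PreL2 H) := by unfold PreL2; infer_instance
noncomputable instance : Module ℂ (F.PreL2 H) := by unfold PreL2; infer_instance
instance : CoeFun (F.PreL2 H) (fun _ => Ω → H) := ⟨fun f => f.1⟩

variable {F}

/-- The function `f`, as an element of the space of square-integrable functions. -/
def mk (f : Ω → H) (hf : (fun ω => ‖f ω‖ ^ 2) ∈ F.domain) : F.PreL2 H := ⟨f, hf⟩

@[simp] theorem mk_apply (f : Ω → H) (hf : (fun ω => ‖f ω‖ ^ 2) ∈ F.domain) (ω : Ω) :
    (mk f hf : F.PreL2 H) ω = f ω := rfl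

@[ext] theorem ext {f g : F.PreL2 H} (h : ∀ ω, f ω = g ω) : f = g := Subtype.ext (funext h)
@[simp] theorem add_apply (f g : F.PreL2 H) (ω : Ω) : (f + g) ω = f ω + g ω := rfl
@[simp] theorem smul_apply (c : ℂ) (f : F.PreL2 H) (ω : Ω) : (c • f) ω = c • f ω := rfl

theorem normSq_mem (f : F.PreL2 H) : (fun ω => ‖f ω‖ ^ 2) ∈ F.domain := f.2

end PreL2

open scoped ComplexConjugate

/-- The inner product is the integral of the pointwise inner product, real and imaginary parts
being integrated separately. -/
noncomputable abbrev preL2Core : PreInnerProductSpace.Core ℂ (F.PreL2 H) where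
  inner f g := ⟨F.toFun fun ω => (inner ℂ (f ω) (g ω)).re,
    F.toFun fun ω => (inner ℂ (f ω) (g ω)).im⟩
  conj_inner_symm f g := by
    apply Complex.ext
    · simp only [Complex.conj_re]
      congr 1; ext ω; rw [← inner_conj_symm (f ω), Complex.conj_re]
    · simp only [Complex.conj_im]
      rw [← map_neg]
      congr 1; ext ω; rw [← inner_conj_symm (f ω), Complex.conj_im]; simp
  re_inner_nonneg f := by
    have : (fun ω => (inner ℂ (f ω) (f ω) : ℂ).re) = fun ω => ‖f ω‖ ^ 2 := by
      ext ω; rw [inner_self_eq_norm_sq_to_K]; norm_cast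
    change 0 ≤ F.toFun _
    rw [this]
    exact F.nonneg f.normSq_mem fun ω => by positivity
  add_left f g k := by
    apply Complex.ext
    · simp only [Complex.add_re, PreL2.add_apply, inner_add_left]
      rw [← map_add]; rfl
    · simp only [Complex.add_im, PreL2.add_apply, inner_add_left]
      rw [← map_add]; rfl
  smul_left f g c := by
    apply Complex.ext
    · simp only [PreL2.smul_apply, inner_smul_left, Complex.mul_re]
      rw [← smul_eq_mul (conj c).re, ← smul_eq_mul (conj c).im, ← map_smul, ← map_smul, ← map_sub]
      rfl
    · simp only [PreL2.smul_apply, inner_smul_left, Complex.mul_im]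
      rw [← smul_eq_mul (conj c).re, ← smul_eq_mul (conj c).im, ← map_smul, ← map_smul, ← map_add]
      rfl

noncomputable instance : SeminormedAddCommGroup (F.PreL2 H) :=
  InnerProductSpace.Core.toSeminormedAddCommGroup (c := F.preL2Core)
noncomputable instance : InnerProductSpace ℂ (F.PreL2 H) :=
  InnerProductSpace.ofCore F.preL2Core

theorem preL2_inner_def (f g : F.PreL2 H) : inner ℂ f g =
    (⟨F.toFun fun ω => (inner ℂ (f ω) (g ω)).re, F.toFun fun ω => (inner ℂ (f ω) (g ω)).im⟩ : ℂ) :=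
  rfl

theorem preL2_norm_sq (f : F.PreL2 H) : ‖f‖ ^ 2 = F.toFun fun ω => ‖f ω‖ ^ 2 := by
  rw [← inner_self_eq_norm_sq (𝕜 := ℂ), preL2_inner_def]
  change F.toFun _ = _
  congr 1; ext ω; rw [inner_self_eq_norm_sq_to_K]; norm_cast

theorem mono {f g : Ω → ℝ} (hg : g ∈ F.domain) (hf : f ∈ F.domain) (h : ∀ ω, f ω ≤ g ω) :
    F.toFun f ≤ F.toFun g := by
  rw [← sub_nonneg, ← map_sub]
  exact F.nonneg (F.domain.sub_mem hg hf) fun ω => sub_nonneg.2 (h ω)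

theorem normSq_comp_mem (a : H →L[ℂ] H) (f : F.PreL2 H) :
    (fun ω => ‖a (f ω)‖ ^ 2) ∈ F.domain :=
  F.solid (F.domain.smul_mem (‖a‖ ^ 2) f.normSq_mem) fun ω => by
    rw [abs_of_nonneg (by positivity)]
    simp only [Pi.smul_apply, smul_eq_mul]
    rw [← mul_pow]
    exact pow_le_pow_left₀ (norm_nonneg _) (a.le_opNorm _) 2

/-- Pointwise application of an operator. -/
noncomputable def preL2Map (a : H →L[ℂ] H) : F.PreL2 H →L[ℂ] F.PreL2 H :=
  LinearMap.mkContinuous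
    { toFun := fun f => PreL2.mk (fun ω => a (f ω)) (F.normSq_comp_mem a f)
      map_add' := fun f g => by ext ω; simp
      map_smul' := fun c f => by ext ω; simp } ‖a‖ fun f => by
    refine le_of_sq_le_sq ?_ (by positivity)
    rw [mul_pow, preL2_norm_sq, preL2_norm_sq, ← smul_eq_mul, ← map_smul]
    refine F.mono (F.domain.smul_mem _ f.normSq_mem) (F.normSq_comp_mem a f) fun ω => ?_
    simp only [Pi.smul_apply, smul_eq_mul]
    rw [← mul_pow]
    exact pow_le_pow_left₀ (norm_nonneg _) (a.le_opNorm _) 2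

@[simp] theorem preL2Map_apply (a : H →L[ℂ] H) (f : F.PreL2 H) (ω : Ω) :
    F.preL2Map a f ω = a (f ω) := rfl

/-- The Hilbert space of square-integrable functions `Ω → H`. -/
abbrev L2 (H : Type*) [NormedAddCommGroup H] [InnerProductSpace ℂ H] : Type _ :=
  UniformSpace.Completion (F.PreL2 H)

open UniformSpace.Completion

variable [CompleteSpace H]

/-- The representation of `B(H)` on the square-integrable functions by pointwise application. -/
noncomputable def rep : (H →L[ℂ] H) →⋆ₐ[ℂ] (F.L2 H →L[ℂ] F.L2 H) where
  toFun a := (F.preL2Map a).completion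
  map_one' := by
    ext x
    induction x using induction_on with
    | hp => apply isClosed_eq <;> fun_prop
    | ih x => simp; congr 1
  map_mul' a b := by
    ext x
    induction x using induction_on with
    | hp => apply isClosed_eq <;> fun_prop
    | ih x => simp; congr 1
  map_zero' := by
    ext x
    induction x using induction_on with
    | hp => apply isClosed_eq <;> fun_prop
    | ih x => simp; rw [← UniformSpace.Completion.coe_zero]; congr 1
  map_add' a b := by
    ext x
    induction x using induction_on with
    | hp => apply isClosed_eq <;> fun_prop
    | ih x => simp; rw [← UniformSpace.Completion.coe_add]; congr 1
  commutes' c := by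
    ext x
    induction x using induction_on with
    | hp => apply isClosed_eq <;> fun_prop
    | ih x =>
      simp [Algebra.algebraMap_eq_smul_one]; rw [← UniformSpace.Completion.coe_smul]; congr 1
  map_star' a := by
    refine (ContinuousLinearMap.eq_adjoint_iff _ _).mpr fun x y => ?_
    induction x, y using induction_on₂ with
    | hp => apply isClosed_eq <;> fun_prop
    | ih x y => simp [preL2_inner_def, ContinuousLinearMap.star_eq_adjoint,
        ContinuousLinearMap.adjoint_inner_left]

@[simp] theorem rep_apply_coe (a : H →L[ℂ] H) (f : F.PreL2 H) :
    F.rep a (f : F.L2 H) = (F.preL2Map a f : F.PreL2 H) :=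
  ContinuousLinearMap.completion_apply_coe _ _

end PositiveFunctional

/-! ### Extension of the form to a positive functional -/

section Extension

variable {H₁ : Type u} {H₂ : Type v} [NormedAddCommGroup H₁] [InnerProductSpace ℂ H₁]
  [NormedAddCommGroup H₂] [InnerProductSpace ℂ H₂]

/-- Coefficients of a form in two families of indeterminate vectors, both indexed by the bare set
`H₁`: the weights of the squared norms of the members of either family, and polynomials that
stand between a member of the first family and one of the second. -/
abbrev FormCoeff (H₁ : Type u) : Type u := (H₁ →₀ ℝ) × (H₁ →₀ ℝ) × ((H₁ × H₁) →₀ ℂ[X])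

/-- The value of the form with given coefficients on the families `α` and `β` and the operator `T`,
with the squared norms multiplied by `c`. -/
noncomputable def form {H : Type*} [NormedAddCommGroup H] [InnerProductSpace ℂ H] (c : ℝ)
    (T : H →L[ℂ] H) (α β : H₁ → H) : FormCoeff H₁ →ₗ[ℝ] ℝ :=
  LinearMap.coprod (c • Finsupp.linearCombination ℝ fun k => ‖α k‖ ^ 2)
    (LinearMap.coprod (c • Finsupp.linearCombination ℝ fun k => ‖β k‖ ^ 2)
      (Finsupp.lsum ℝ fun kh : H₁ × H₁ =>
        { toFun := fun q : ℂ[X] => 2 * (inner ℂ (α kh.1) (aeval T q (β kh.2))).re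
          map_add' := fun p q => by simp [mul_add]
          map_smul' := fun r q => by
            have : r • q = (r : ℂ) • q := by ext; simp
            rw [this]
            simp [-Complex.coe_smul, mul_left_comm] }))

omit [NormedAddCommGroup H₁] [InnerProductSpace ℂ H₁] in
theorem form_eq_sum {H : Type*} [NormedAddCommGroup H] [InnerProductSpace ℂ H] (c : ℝ)
    (T : H →L[ℂ] H) (α β : H₁ → H) (d : FormCoeff H₁) {s : Finset H₁} (h₁ : d.1.support ⊆ s)
    (h₂ : d.2.1.support ⊆ s) (h₃ : d.2.2.support ⊆ s ×ˢ s) :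
    form c T α β d = c * (∑ k ∈ s, d.1 k * ‖α k‖ ^ 2 + ∑ h ∈ s, d.2.1 h * ‖β h‖ ^ 2) +
      2 * (∑ k ∈ s, ∑ h ∈ s, inner ℂ (α k) (aeval T (d.2.2 (k, h)) (β h))).re := by
  simp only [form, LinearMap.coprod_apply, LinearMap.smul_apply, Finsupp.linearCombination_apply,
    Finsupp.lsum_apply, smul_eq_mul]
  rw [Finsupp.sum_of_support_subset _ h₁ _ (by simp),
    Finsupp.sum_of_support_subset _ h₂ _ (by simp),
    Finsupp.sum_of_support_subset _ h₃ _ (by simp)]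
  simp only [LinearMap.coe_mk, AddHom.coe_mk, ← Finset.mul_sum, ← Complex.re_sum]
  rw [Finset.sum_product]
  ring

/-- The functional prescribed by `T₁` is positive on the forms that are positive for `T₂`. -/
theorem CompletelyDominatedWithBound.form_nonneg_of_forall {T₁ : H₁ →L[ℂ] H₁} {T₂ : H₂ →L[ℂ] H₂}
    {M : ℝ} (hM : 0 ≤ M) (h : CompletelyDominatedWithBound M T₁ T₂) (d : FormCoeff H₁)
    (hd : ∀ α β : H₁ → H₂, 0 ≤ form 1 T₂ α β d) : 0 ≤ form M T₁ id id d := by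
  classical
  -- The index set is made nonempty, since dominance concerns matrices of positive size.
  set s : Finset H₁ := insert 0 (d.1.support ∪ d.2.1.support ∪
    (d.2.2.support.image Prod.fst ∪ d.2.2.support.image Prod.snd)) with hs
  have h₁ : d.1.support ⊆ s := fun k hk => by
    simp only [hs, Finset.mem_insert, Finset.mem_union]; tauto
  have h₂ : d.2.1.support ⊆ s := fun k hk => by
    simp only [hs, Finset.mem_insert, Finset.mem_union]; tauto
  have h₃ : d.2.2.support ⊆ s ×ˢ s := fun k hk => by
    have hk1 := Finset.mem_image_of_mem Prod.fst hk
    have hk2 := Finset.mem_image_of_mem Prod.snd hk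
    simp only [hs, Finset.mem_product, Finset.mem_insert, Finset.mem_union]; tauto
  have hn : 0 < s.card := Finset.card_pos.2 ⟨0, Finset.mem_insert_self _ _⟩
  have sum_fin : ∀ {X : Type} [AddCommMonoid X] (f : H₁ → X),
      ∑ k ∈ s, f k = ∑ i, f (s.equivFin.symm i) := fun f => by
    rw [← Finset.sum_coe_sort, ← Equiv.sum_comp s.equivFin.symm]
  rcases subsingleton_or_nontrivial H₂ with hH | hH
  · -- If `H₂ = 0` then all bounds vanish, so that `H₁ = 0`.
    have h0 : ∀ x : H₁, x = 0 := fun x => by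
      have hp : ‖polyMatrix (1 : Matrix (Fin 1) (Fin 1) ℂ[X]) T₁‖ ≤ 0 := by
        refine (h 1 one_pos 1).trans_eq ?_
        have h2 : polyMatrix (1 : Matrix (Fin 1) (Fin 1) ℂ[X]) T₂ = 0 := by
          ext x i
          exact Subsingleton.elim _ _
        rw [h2, norm_zero, mul_zero]
      have hx := polyMatrix_apply 1 T₁ (WithLp.toLp 2 fun _ : Fin 1 => x) 0
      have hp0 := (polyMatrix (1 : Matrix (Fin 1) (Fin 1) ℂ[X]) T₁).le_of_opNorm_le hp
        (WithLp.toLp 2 fun _ => x)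
      rw [zero_mul, norm_le_zero_iff] at hp0
      rw [hp0] at hx
      simpa using hx.symm
    rw [form_eq_sum M T₁ id id d h₁ h₂ h₃]
    simp [h0]
  · rw [form_eq_sum M T₁ id id d h₁ h₂ h₃]
    simp only [sum_fin]
    refine h.form_nonneg hM hn (fun i => d.1 (s.equivFin.symm i))
      (fun i => d.2.1 (s.equivFin.symm i))
      (Matrix.of fun i j => d.2.2 (s.equivFin.symm i, s.equivFin.symm j)) (fun η ζ => ?_)
      (fun i => s.equivFin.symm i) (fun i => s.equivFin.symm i)
    have := hd (fun x => if hx : x ∈ s then η (s.equivFin ⟨x, hx⟩) else 0)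
      (fun x => if hx : x ∈ s then ζ (s.equivFin ⟨x, hx⟩) else 0)
    rw [form_eq_sum _ _ _ _ d h₁ h₂ h₃] at this
    simpa only [sum_fin, Matrix.of_apply, Finset.coe_mem, dite_true, Subtype.coe_eta,
      Equiv.apply_symm_apply,
      one_mul] using this

/-- The set on which functions are integrated: all pairs of families of vectors of `H₂` that are
indexed by the bare set `H₁`. The lift serves to reach any larger universe. -/
abbrev FamilyPairs (H₁ : Type u) (H₂ : Type v) : Type (max u v w) :=
  ULift.{w} ((H₁ → H₂) × (H₁ → H₂))

/-- The form of `T₂` as a function on the pairs of families. -/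
noncomputable def formFun (T₂ : H₂ →L[ℂ] H₂) :
    FormCoeff H₁ →ₗ[ℝ] FamilyPairs.{u, v, w} H₁ H₂ → ℝ :=
  LinearMap.pi fun ω => form 1 T₂ ω.down.1 ω.down.2

/-- The functions on the pairs of families that some form dominates in absolute value. -/
def formDominated (H₁ : Type u) (T₂ : H₂ →L[ℂ] H₂) :
    Submodule ℝ (FamilyPairs.{u, v, w} H₁ H₂ → ℝ) where
  carrier := {f | ∃ d : FormCoeff H₁, ∀ ω, |f ω| ≤ formFun T₂ d ω}
  zero_mem' := ⟨0, by simp⟩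
  add_mem' := by
    rintro f g ⟨d, hd⟩ ⟨e, he⟩
    refine ⟨d + e, fun ω => (abs_add_le _ _).trans ?_⟩
    rw [map_add]
    exact add_le_add (hd ω) (he ω)
  smul_mem' := by
    rintro r f ⟨d, hd⟩
    refine ⟨|r| • d, fun ω => ?_⟩
    rw [map_smul, Pi.smul_apply, Pi.smul_apply, smul_eq_mul, abs_mul, smul_eq_mul]
    exact mul_le_mul_of_nonneg_left (hd ω) (abs_nonneg r)

/-- The functional on forms prescribed by `T₁` and `M` extends to a positive functional on all
functions that forms in `T₂` dominate. -/
theorem exists_positiveFunctional_form {T₁ : H₁ →L[ℂ] H₁} {T₂ : H₂ →L[ℂ] H₂}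
    {M : ℝ} (hM : 0 ≤ M) (h : CompletelyDominatedWithBound M T₁ T₂) :
    ∃ F : PositiveFunctional (FamilyPairs.{u, v, w} H₁ H₂), F.domain = formDominated H₁ T₂ ∧
      ∀ d, formFun T₂ d ∈ F.domain → F.toFun (formFun T₂ d) = form M T₁ id id d := by
  set Y := formDominated.{u, v, w} H₁ T₂ with hY
  -- Adjoining the coefficients as a direct summand makes the prescribed functional defined without
  -- checking that it depends on the form only; the cone enforces this afterwards.
  let s : PointedCone ℝ (FormCoeff H₁ × Y) :=
    { carrier := {z | ∀ ω, 0 ≤ formFun T₂ z.1 ω + (z.2 : FamilyPairs.{u, v, w} H₁ H₂ → ℝ) ω}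
      zero_mem' := by simp
      add_mem' := by
        intro a b ha hb ω
        have := add_nonneg (ha ω) (hb ω)
        simp only [Prod.fst_add, Prod.snd_add, map_add, Pi.add_apply, Submodule.coe_add]
        linarith
      smul_mem' := by
        intro c a ha ω
        have := mul_nonneg c.2 (ha ω)
        change 0 ≤ formFun T₂ ((c : ℝ) • a.1) ω + (c : ℝ) * (a.2 : _ → ℝ) ω
        rw [map_smul, Pi.smul_apply, smul_eq_mul]
        linarith }
  have mem_s : ∀ d (y : Y), (d, y) ∈ s ↔
      ∀ ω, 0 ≤ formFun T₂ d ω + (y : FamilyPairs.{u, v, w} H₁ H₂ → ℝ) ω := fun _ _ => Iff.rfl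
  let f : (FormCoeff H₁ × Y) →ₗ.[ℝ] ℝ :=
    { domain := Submodule.prod ⊤ ⊥
      toFun := form M T₁ id id ∘ₗ LinearMap.fst ℝ _ _ ∘ₗ Submodule.subtype _ }
  obtain ⟨G, hGf, hGs⟩ := riesz_extension s f
    (by
      rintro ⟨⟨d, y⟩, hy⟩ hs
      obtain rfl : y = 0 := hy.2
      refine h.form_nonneg_of_forall hM d fun α β => ?_
      simpa [formFun] using (mem_s d 0).1 hs ⟨(α, β)⟩)
    (by
      rintro ⟨d, y, e, he⟩
      refine ⟨⟨(e - d, 0), ⟨trivial, rfl⟩⟩, fun ω => ?_⟩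
      simpa using neg_le_iff_add_nonneg'.1 ((abs_le.1 (he ω)).1))
  obtain ⟨F, hF⟩ := LinearMap.exists_extend (G ∘ₗ LinearMap.inr ℝ (FormCoeff H₁) Y)
  have hF' : ∀ y : Y, F y = G (0, y) := fun y => DFunLike.congr_fun hF y
  refine ⟨⟨Y, F, ?_, ?_⟩, rfl, fun d hd => ?_⟩
  · rintro f g ⟨d, hd⟩ hfg
    exact ⟨d, fun ω => (hfg ω).trans ((le_abs_self _).trans (hd ω))⟩
  · intro f hf h0
    rw [hF' ⟨f, hf⟩]
    exact hGs _ ((mem_s _ _).2 fun ω => by simpa using h0 ω)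
  · change F (formFun T₂ d) = _
    rw [hF' ⟨_, hd⟩]
    have h1 : G (d, 0) = form M T₁ id id d := hGf ⟨(d, 0), ⟨trivial, rfl⟩⟩
    have h2 := hGs (d, -⟨_, hd⟩) ((mem_s _ _).2 fun ω => by simp)
    have h3 := hGs (-d, ⟨_, hd⟩) ((mem_s _ _).2 fun ω => by simp)
    have e2 : ((d, -⟨_, hd⟩) : FormCoeff H₁ × Y) = (d, 0) - (0, ⟨_, hd⟩) := by simp
    have e3 : ((-d, ⟨_, hd⟩) : FormCoeff H₁ × Y) = (0, ⟨_, hd⟩) - (d, 0) := by simp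
    rw [e2, map_sub] at h2
    rw [e3, map_sub] at h3
    linarith

/-- **Factorization.** Dominance with bound `M` gives a representation `π` of `B(H₂)` and maps `v`
and `w` into its space, with squared norms `M‖h‖²`, such that `q(T₁)` is the compression of
`π(q(T₂))` along `v` and `w`. These maps are evaluations of families at an index, and need not be
linear. -/
theorem CompletelyDominatedWithBound.exists_representation [CompleteSpace H₂] {T₁ : H₁ →L[ℂ] H₁}
    {T₂ : H₂ →L[ℂ] H₂} {M : ℝ} (hM : 0 ≤ M) (h : CompletelyDominatedWithBound M T₁ T₂) :
    ∃ (K : Type (max u v w)) (_ : NormedAddCommGroup K) (_ : InnerProductSpace ℂ K)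
      (_ : CompleteSpace K) (π : (H₂ →L[ℂ] H₂) →⋆ₐ[ℂ] (K →L[ℂ] K)) (v w : H₁ → K),
      (∀ k, ‖v k‖ ^ 2 = M * ‖k‖ ^ 2) ∧ (∀ k, ‖w k‖ ^ 2 = M * ‖k‖ ^ 2) ∧
      ∀ (q : ℂ[X]) k h, inner ℂ (v k) (aeval (π T₂) q (w h)) = inner ℂ k (aeval T₁ q h) := by
  obtain ⟨F, hdom, hF⟩ := exists_positiveFunctional_form.{u, v, w} hM h
  have eη : ∀ k : H₁, formFun T₂ (Finsupp.single k 1, 0, 0) =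
      fun ω : FamilyPairs.{u, v, w} H₁ H₂ => ‖ω.down.1 k‖ ^ 2 := fun k => by
    ext ω; simp [formFun, form]
  have eζ : ∀ k : H₁, formFun T₂ (0, Finsupp.single k 1, 0) =
      fun ω : FamilyPairs.{u, v, w} H₁ H₂ => ‖ω.down.2 k‖ ^ 2 := fun k => by
    ext ω; simp [formFun, form]
  have eq : ∀ (k h : H₁) (q : ℂ[X]), formFun T₂ (0, 0, Finsupp.single (k, h) q) =
      fun ω : FamilyPairs.{u, v, w} H₁ H₂ =>
        2 * (inner ℂ (ω.down.1 k) (aeval T₂ q (ω.down.2 h))).re := fun k h q => by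
    ext ω; simp [formFun, form]
  have mη : ∀ k : H₁, (fun ω : FamilyPairs.{u, v, w} H₁ H₂ => ‖ω.down.1 k‖ ^ 2) ∈ F.domain := by
    intro k
    rw [hdom]
    exact ⟨(Finsupp.single k 1, 0, 0), fun ω => by rw [eη, abs_of_nonneg (by positivity)]⟩
  have mζ : ∀ k : H₁, (fun ω : FamilyPairs.{u, v, w} H₁ H₂ => ‖ω.down.2 k‖ ^ 2) ∈ F.domain := by
    intro k
    rw [hdom]
    exact ⟨(0, Finsupp.single k 1, 0), fun ω => by rw [eζ, abs_of_nonneg (by positivity)]⟩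
  have mq : ∀ (k h : H₁) (q : ℂ[X]), formFun T₂ (0, 0, Finsupp.single (k, h) q) ∈ F.domain := by
    intro k h q
    rw [eq]
    refine F.solid (F.domain.smul_mem ‖aeval T₂ q‖ (F.domain.add_mem (mη k) (mζ h))) fun ω => ?_
    have h1 := (Complex.abs_re_le_norm _).trans
      (norm_inner_le_norm (𝕜 := ℂ) (ω.down.1 k) (aeval T₂ q (ω.down.2 h)))
    have h2 := mul_le_mul_of_nonneg_left ((aeval T₂ q).le_opNorm (ω.down.2 h))
      (norm_nonneg (ω.down.1 k))
    have h3 := mul_nonneg (norm_nonneg (aeval T₂ q)) (sq_nonneg (‖ω.down.1 k‖ - ‖ω.down.2 h‖))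
    rw [abs_mul, abs_two]
    simp only [Pi.smul_apply, Pi.add_apply, smul_eq_mul]
    nlinarith
  have re_eq : ∀ (k h : H₁) (q : ℂ[X]), (F.toFun fun ω : FamilyPairs.{u, v, w} H₁ H₂ =>
      (inner ℂ (ω.down.1 k) (aeval T₂ q (ω.down.2 h))).re) = (inner ℂ k (aeval T₁ q h)).re := by
    intro k h q
    have := hF _ (mq k h q)
    rw [eq] at this
    have e : (fun ω : FamilyPairs.{u, v, w} H₁ H₂ =>
        2 * (inner ℂ (ω.down.1 k) (aeval T₂ q (ω.down.2 h))).re) =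
        (2 : ℝ) • fun ω => (inner ℂ (ω.down.1 k) (aeval T₂ q (ω.down.2 h))).re := rfl
    rw [e, map_smul] at this
    simpa [form] using this
  refine ⟨F.L2 H₂, inferInstance, inferInstance, inferInstance, F.rep,
    fun k => (PositiveFunctional.PreL2.mk (fun ω => ω.down.1 k) (mη k) : F.PreL2 H₂),
    fun k => (PositiveFunctional.PreL2.mk (fun ω => ω.down.2 k) (mζ k) : F.PreL2 H₂), ?_, ?_, ?_⟩
  · intro k
    rw [UniformSpace.Completion.norm_coe, F.preL2_norm_sq]
    have := hF _ (eη k ▸ mη k)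
    rw [eη] at this
    simpa [form] using this
  · intro k
    rw [UniformSpace.Completion.norm_coe, F.preL2_norm_sq]
    have := hF _ (eζ k ▸ mζ k)
    rw [eζ] at this
    simpa [form] using this
  · intro q k h
    have : aeval (F.rep T₂) q = F.rep (aeval T₂ q) :=
      Polynomial.aeval_algHom_apply F.rep.toAlgHom T₂ q
    rw [this, F.rep_apply_coe, UniformSpace.Completion.inner_coe, F.preL2_inner_def]
    apply Complex.ext
    · exact re_eq k h q
    · -- The imaginary part of a number is the real part of its product with `-i`.
      simpa [inner_smul_right] using re_eq k h (-Complex.I • q)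

end Extension

/-! ### Similarity to a compression -/

section Similarity

open Submodule

variable {H K : Type*} [NormedAddCommGroup H] [InnerProductSpace ℂ H] [CompleteSpace H]
  [NormedAddCommGroup K] [InnerProductSpace ℂ K] [CompleteSpace K]

/-- A factorization of the polynomials in `T` through those in `R`, along maps `v` and `w` that
need not be linear, makes `T` similar to the compression of `R` to a semi-invariant subspace `E`.
The subspace `N₁` is spanned by the vectors `q(R) w h`; on it the vectors `v k` determine a
bounded linear map `S` to `H` that sends `q(R) w h` to `q(T) h`, so that it intertwines `R` and `T`;
and `E` is the complement of the kernel of `S` in `N₁`. -/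
theorem exists_semiInvariant_similar {T : H →L[ℂ] H} {R : K →L[ℂ] K} {v w : H → K} {c : ℝ}
    (hc : 0 ≤ c) (hv : ∀ k, ‖v k‖ ≤ c * ‖k‖) (hw : ∀ k, ‖w k‖ ≤ c * ‖k‖)
    (hvw : ∀ (q : ℂ[X]) k h, inner ℂ (v k) (aeval R q (w h)) = inner ℂ k (aeval T q h)) :
    ∃ (E : Submodule ℂ K) (_ : E.HasOrthogonalProjection) (S : E ≃L[ℂ] H), IsSemiInvariant R E ∧
      (∀ x, S (compression E R x) = T (S x)) ∧ (∀ x, ‖S x‖ ≤ c * ‖x‖) ∧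
      ∀ h, ‖S.symm h‖ ≤ c * ‖h‖ := by
  set N₁ : Submodule ℂ K :=
    (span ℂ (Set.range fun z : ℂ[X] × H => aeval R z.1 (w z.2))).topologicalClosure with hN₁
  have hcl₁ : IsClosed (N₁ : Set K) := isClosed_topologicalClosure _
  have : CompleteSpace N₁ := hcl₁.completeSpace_coe
  have gen : ∀ (q : ℂ[X]) h, aeval R q (w h) ∈ N₁ := fun q h =>
    le_topologicalClosure _ (subset_span ⟨(q, h), rfl⟩)
  have wmem : ∀ h, w h ∈ N₁ := fun h => by simpa using gen 1 h
  -- A closed subspace contains `N₁` as soon as it contains the generators.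
  have N₁_le : ∀ P : Submodule ℂ K, IsClosed (P : Set K) → (∀ (q : ℂ[X]) h, aeval R q (w h) ∈ P) →
      N₁ ≤ P := fun P hP hq =>
    topologicalClosure_minimal _ (span_le.2 (by rintro _ ⟨z, rfl⟩; exact hq _ _)) hP
  have inv₁ : ∀ x ∈ N₁, R x ∈ N₁ := by
    refine N₁_le (N₁.comap (R : K →ₗ[ℂ] K)) (hcl₁.preimage R.continuous) fun q h => ?_
    have := gen (X * q) h
    simpa using this
  have eq_of_inner : ∀ x ∈ N₁, ∀ y ∈ N₁, (∀ (q : ℂ[X]) h,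
      inner ℂ x (aeval R q (w h)) = inner ℂ y (aeval R q (w h))) → x = y := by
    intro x hx y hy hxy
    have h1 : N₁ ≤ (ℂ ∙ (x - y))ᗮ := by
      refine N₁_le _ (isClosed_orthogonal _) fun q h => ?_
      rw [mem_orthogonal_singleton_iff_inner_right, inner_sub_left, hxy, sub_self]
    have h2 := h1 (N₁.sub_mem hx hy)
    rw [mem_orthogonal_singleton_iff_inner_right, inner_self_eq_zero] at h2
    exact sub_eq_zero.1 h2
  have inner_proj : ∀ (k : H) (x : K), x ∈ N₁ →
      inner ℂ (N₁.starProjection (v k)) x = inner ℂ (v k) x := fun k x hx => by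
    rw [inner_starProjection_left_eq_right, starProjection_eq_self_iff.2 hx]
  -- The projections of the vectors `v k` to `N₁` depend linearly on `k`.
  let V : H →L[ℂ] K := LinearMap.mkContinuous
    { toFun := fun k => N₁.starProjection (v k)
      map_add' := fun k l => by
        refine eq_of_inner _ (starProjection_apply_mem _ _) _
          (N₁.add_mem (starProjection_apply_mem _ _) (starProjection_apply_mem _ _)) fun q h => ?_
        rw [inner_add_left]
        simp only [inner_proj _ _ (gen q h), hvw, inner_add_left]
      map_smul' := fun a k => by
        refine eq_of_inner _ (starProjection_apply_mem _ _) _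
          (N₁.smul_mem _ (starProjection_apply_mem _ _)) fun q h => ?_
        simp only [inner_smul_left, inner_proj _ _ (gen q h), hvw, RingHom.id_apply] } c fun k =>
    (N₁.norm_starProjection_apply_le (v k)).trans (hv k)
  have hVn : ‖V‖ ≤ c := LinearMap.mkContinuous_norm_le _ hc _
  let S : K →L[ℂ] H := ContinuousLinearMap.adjoint V
  have hSn : ∀ x, ‖S x‖ ≤ c * ‖x‖ := fun x =>
    (S.le_opNorm x).trans (by gcongr; simpa [S] using hVn)
  have hS : ∀ (q : ℂ[X]) h, S (aeval R q (w h)) = aeval T q h := by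
    intro q h
    refine ext_inner_left ℂ fun k => ?_
    rw [ContinuousLinearMap.adjoint_inner_right, ← hvw]
    exact inner_proj k _ (gen q h)
  have hSw : ∀ h, S (w h) = h := fun h => by simpa using hS 1 h
  have hSR : ∀ x ∈ N₁, S (R x) = T (S x) := by
    refine N₁_le (LinearMap.eqLocus ((S ∘L R : K →L[ℂ] H) : K →ₗ[ℂ] H)
      ((T ∘L S : K →L[ℂ] H) : K →ₗ[ℂ] H)) ?_ fun q h => ?_
    · exact isClosed_eq (S ∘L R).continuous (T ∘L S).continuous
    · have := hS (X * q) h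
      simp only [map_mul, aeval_X, mul_apply_eq_comp] at this
      change S (R (aeval R q (w h))) = T (S (aeval R q (w h)))
      rw [this, hS]
  set N₂ : Submodule ℂ K := N₁ ⊓ LinearMap.ker (S : K →ₗ[ℂ] H) with hN₂
  have hcl₂ : IsClosed (N₂ : Set K) := hcl₁.inter (ContinuousLinearMap.isClosed_ker S)
  have : CompleteSpace N₂ := hcl₂.completeSpace_coe
  have inv₂ : ∀ x ∈ N₂, R x ∈ N₂ := fun x hx => ⟨inv₁ x hx.1, by
    have h0 : S x = 0 := hx.2
    change S (R x) = 0
    rw [hSR x hx.1, h0, map_zero]⟩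
  have hclE : IsClosed ((N₁ ⊓ N₂ᗮ : Submodule ℂ K) : Set K) :=
    hcl₁.inter (isClosed_orthogonal _)
  have : CompleteSpace (N₁ ⊓ N₂ᗮ : Submodule ℂ K) := hclE.completeSpace_coe
  have projE : ∀ x ∈ N₁, x - N₂.starProjection x ∈ N₁ ⊓ N₂ᗮ := fun x hx =>
    ⟨N₁.sub_mem hx (N₂.starProjection_apply_mem x).1, N₂.sub_starProjection_mem_orthogonal x⟩
  have hSproj : ∀ x, S (x - N₂.starProjection x) = S x := fun x => by
    have h0 : S (N₂.starProjection x) = 0 := (N₂.starProjection_apply_mem x).2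
    rw [map_sub, h0, sub_zero]
  have hSE : ∀ x ∈ N₁, S ((N₁ ⊓ N₂ᗮ).starProjection x) = S x := by
    intro x hx
    rw [Submodule.eq_starProjection_of_mem_orthogonal (projE x hx) ?_, hSproj]
    rw [sub_sub_cancel, Submodule.mem_orthogonal]
    exact fun u hu => Submodule.inner_left_of_mem_orthogonal (N₂.starProjection_apply_mem x) hu.2
  let A : (N₁ ⊓ N₂ᗮ : Submodule ℂ K) →L[ℂ] H := S ∘L (N₁ ⊓ N₂ᗮ).subtypeL
  have hinj : Function.Injective A := by
    refine (injective_iff_map_eq_zero A).2 fun x hx => Subtype.ext ?_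
    have h2 : (x : K) ∈ N₂ := ⟨x.2.1, hx⟩
    exact inner_self_eq_zero.1 (x.2.2 _ h2)
  have hsurj : Function.Surjective A := fun h =>
    ⟨⟨_, projE _ (wmem h)⟩, (hSproj _).trans (hSw h)⟩
  let e : (N₁ ⊓ N₂ᗮ : Submodule ℂ K) ≃L[ℂ] H :=
    ContinuousLinearEquiv.ofBijective A (LinearMap.ker_eq_bot.2 hinj)
      (LinearMap.range_eq_top.2 hsurj)
  have he : ∀ x, e x = S x := fun x => rfl
  refine ⟨N₁ ⊓ N₂ᗮ, inferInstance, e, ⟨N₁, N₂, hcl₁, hcl₂, inf_le_left, inv₁, inv₂, rfl⟩,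
    fun x => ?_, fun x => hSn x, fun h => ?_⟩
  · rw [he, he]
    change S ((N₁ ⊓ N₂ᗮ).starProjection (R x)) = _
    rw [hSE _ (inv₁ _ x.2.1), hSR _ x.2.1]
  · have h1 : e.symm h = ⟨_, projE _ (wmem h)⟩ := by
      rw [ContinuousLinearEquiv.symm_apply_eq, he]
      exact ((hSproj _).trans (hSw h)).symm
    rw [h1]
    change ‖w h - N₂.starProjection (w h)‖ ≤ _
    rw [← starProjection_orthogonal_val]
    exact (norm_starProjection_apply_le _ _).trans (hw h)

/-- An isomorphism of Hilbert spaces is the product of a unitary and an invertible operator on the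
target, with the same bounds. -/
theorem exists_unitary_factor {E : Type*} [NormedAddCommGroup E] [InnerProductSpace ℂ E]
    [CompleteSpace E] (S : E ≃L[ℂ] H) {c : ℝ} (hc : 0 ≤ c) (h₁ : ∀ x, ‖S x‖ ≤ c * ‖x‖)
    (h₂ : ∀ y, ‖S.symm y‖ ≤ c * ‖y‖) :
    ∃ (L : (H →L[ℂ] H)ˣ) (U : E ≃ₗᵢ[ℂ] H), (∀ x, S x = (L : H →L[ℂ] H) (U x)) ∧
      ‖(L : H →L[ℂ] H)‖ ≤ c ∧ ‖(↑L⁻¹ : H →L[ℂ] H)‖ ≤ c := by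
  let A : E →L[ℂ] H := S
  let B : H →L[ℂ] E := S.symm
  let A' := ContinuousLinearMap.adjoint A
  let B' := ContinuousLinearMap.adjoint B
  have hAB : A ∘L B = .id ℂ H := by ext; simp [A, B]
  have hBA : B ∘L A = .id ℂ E := by ext; simp [A, B]
  have hBA' : B' ∘L A' = .id ℂ H := by
    rw [← ContinuousLinearMap.adjoint_comp, hAB, ContinuousLinearMap.adjoint_id]
  have hAB' : A' ∘L B' = .id ℂ E := by
    rw [← ContinuousLinearMap.adjoint_comp, hBA, ContinuousLinearMap.adjoint_id]
  -- The positive factor is the square root of `S S⋆`.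
  let P : H →L[ℂ] H := A ∘L A'
  have hP : 0 ≤ P := by
    rw [ContinuousLinearMap.nonneg_iff_isPositive]
    exact ContinuousLinearMap.isPositive_self_comp_adjoint A
  have hPu : IsUnit P := by
    refine ⟨⟨P, B' ∘L B, ?_, ?_⟩, rfl⟩
    · ext x
      have := DFunLike.congr_fun hAB' (B x)
      simpa [P, A, B] using congrArg A this
    · ext x
      have := DFunLike.congr_fun hBA (A' x)
      have h2 := DFunLike.congr_fun hBA' x
      simpa [P, A, B] using (congrArg B' this).trans h2
  obtain ⟨L, hL⟩ := (CFC.isUnit_sqrt_iff P hP).2 hPu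
  have hLL : ∀ x, (L : H →L[ℂ] H) ((L : H →L[ℂ] H) x) = A (A' x) := fun x => by
    have := DFunLike.congr_fun (CFC.sqrt_mul_sqrt_self P hP) x
    rwa [← hL] at this
  have hLsa : ∀ x y, inner ℂ ((L : H →L[ℂ] H) x) y = inner ℂ x ((L : H →L[ℂ] H) y) := by
    have h0 : (0 : H →L[ℂ] H) ≤ L := hL ▸ CFC.sqrt_nonneg P
    exact (ContinuousLinearMap.nonneg_iff_isPositive _).1 h0 |>.isSymmetric
  have hnorm : ∀ x, ‖A' x‖ = ‖(L : H →L[ℂ] H) x‖ := fun x => by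
    rw [← sq_eq_sq₀ (norm_nonneg _) (norm_nonneg _), ← inner_self_eq_norm_sq (𝕜 := ℂ),
      ← inner_self_eq_norm_sq (𝕜 := ℂ), hLsa, hLL, ContinuousLinearMap.adjoint_inner_left]
  have hLr : ∀ x, (L : H →L[ℂ] H) ((↑L⁻¹ : H →L[ℂ] H) x) = x := fun x => by
    rw [← mul_apply_eq_comp, Units.mul_inv, one_apply_eq_self]
  have hLl : ∀ x, (↑L⁻¹ : H →L[ℂ] H) ((L : H →L[ℂ] H) x) = x := fun x => by
    rw [← mul_apply_eq_comp, Units.inv_mul, one_apply_eq_self]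
  let W : H ≃ₗᵢ[ℂ] E := LinearIsometryEquiv.ofSurjective
    { toLinearMap := (A' ∘L (↑L⁻¹ : H →L[ℂ] H) : H →ₗ[ℂ] E)
      norm_map' := fun x => by
        change ‖A' ((↑L⁻¹ : H →L[ℂ] H) x)‖ = ‖x‖
        rw [hnorm, hLr] }
    fun y => ⟨(L : H →L[ℂ] H) (B' y), by
      change A' ((↑L⁻¹ : H →L[ℂ] H) ((L : H →L[ℂ] H) (B' y))) = y
      rw [hLl]
      exact DFunLike.congr_fun hAB' y⟩
  have hSW : ∀ x, S (W x) = (L : H →L[ℂ] H) x := fun x => by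
    change A (A' ((↑L⁻¹ : H →L[ℂ] H) x)) = _
    rw [← hLL, hLr]
  refine ⟨L, W.symm, fun x => by rw [← hSW, W.apply_symm_apply], ?_, ?_⟩
  · refine ContinuousLinearMap.opNorm_le_bound _ hc fun x => ?_
    rw [← hSW]
    exact (h₁ _).trans_eq (by rw [W.norm_map])
  · refine ContinuousLinearMap.opNorm_le_bound _ hc fun x => ?_
    have : (↑L⁻¹ : H →L[ℂ] H) x = W.symm (S.symm x) := by
      rw [W.eq_symm_apply, S.eq_symm_apply, hSW, hLr]
    rw [this, LinearIsometryEquiv.norm_map]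
    exact h₂ x

end Similarity

/-! ### Dominance with a bound -/

section Dominance

variable {H₁ : Type u} {H₂ : Type v}
  [NormedAddCommGroup H₁] [InnerProductSpace ℂ H₁] [CompleteSpace H₁]
  [NormedAddCommGroup H₂] [InnerProductSpace ℂ H₂] [CompleteSpace H₂]
  {T₁ : H₁ →L[ℂ] H₁} {T₂ : H₂ →L[ℂ] H₂} {M : ℝ}

/-- Dominance with bound `M` makes `T₁` similar to a compression of `π(T₂)`, the two maps of the
similarity having norm at most `√M`. -/
theorem CompletelyDominatedWithBound.exists_compression (hM : 0 ≤ M)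
    (h : CompletelyDominatedWithBound M T₁ T₂) :
    ∃ (K : Type (max u v w)) (_ : NormedAddCommGroup K) (_ : InnerProductSpace ℂ K)
      (_ : CompleteSpace K) (π : (H₂ →L[ℂ] H₂) →⋆ₐ[ℂ] (K →L[ℂ] K)) (E : Submodule ℂ K)
      (_ : E.HasOrthogonalProjection) (S : E ≃L[ℂ] H₁), IsSemiInvariant (π T₂) E ∧
      (∀ x, S (compression E (π T₂) x) = T₁ (S x)) ∧ (∀ x, ‖S x‖ ≤ √M * ‖x‖) ∧
      ∀ x, ‖S.symm x‖ ≤ √M * ‖x‖ := by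
  obtain ⟨K, _, _, _, π, v, w, hv, hw, hvw⟩ := h.exists_representation hM
  have norm_le : ∀ (x : K) (k : H₁), ‖x‖ ^ 2 = M * ‖k‖ ^ 2 → ‖x‖ ≤ √M * ‖k‖ := fun x k hx => by
    refine le_of_sq_le_sq ?_ (by positivity)
    rw [mul_pow, Real.sq_sqrt hM, hx]
  obtain ⟨E, hE, S, hS⟩ := exists_semiInvariant_similar (Real.sqrt_nonneg M)
    (fun k => norm_le _ _ (hv k)) (fun k => norm_le _ _ (hw k)) hvw
  exact ⟨K, inferInstance, inferInstance, inferInstance, π, E, hE, S, hS⟩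

/-- The polar decomposition moves the similarity from the semi-invariant subspace to `H₁`. -/
theorem CompletelyDominatedWithBound.exists_similar (hM : 0 ≤ M)
    (h : CompletelyDominatedWithBound M T₁ T₂) :
    ∃ L : (H₁ →L[ℂ] H₁)ˣ,
      CompletelyDominated ((↑L⁻¹ : H₁ →L[ℂ] H₁) * T₁ * (L : H₁ →L[ℂ] H₁)) T₂ ∧
      ‖(↑L⁻¹ : H₁ →L[ℂ] H₁)‖ * ‖(L : H₁ →L[ℂ] H₁)‖ ≤ M := by
  obtain ⟨K, _, _, _, π, E, hE, S, hsemi, hS, hS₁, hS₂⟩ := exists_compression.{u, v, 0} hM h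
  have : CompleteSpace E := by
    obtain ⟨N₁, N₂, hcl, -, -, -, -, rfl⟩ := hsemi
    exact (hcl.inter (Submodule.isClosed_orthogonal _)).completeSpace_coe
  obtain ⟨L, U, hLU, hL, hL'⟩ := exists_unitary_factor S (Real.sqrt_nonneg M) hS₁ hS₂
  refine ⟨L, completelyDominated_of_compression π E hsemi
    (UnitarilyEquivalent.symm ⟨U, fun x => ?_⟩), ?_⟩
  · have hL_inv : ∀ x, (↑L⁻¹ : H₁ →L[ℂ] H₁) ((L : H₁ →L[ℂ] H₁) x) = x := fun x => by
      rw [← mul_apply_eq_comp, Units.inv_mul, one_apply_eq_self]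
    simp only [mul_apply_eq_comp]
    rw [← hLU, ← hS, hLU, hL_inv]
  · calc _ ≤ √M * √M := by gcongr
      _ = M := Real.mul_self_sqrt hM

omit [CompleteSpace H₁] [CompleteSpace H₂] in
theorem CompletelyDominated.withBound_of_similar (L : (H₁ →L[ℂ] H₁)ˣ)
    (h : CompletelyDominated ((↑L⁻¹ : H₁ →L[ℂ] H₁) * T₁ * (L : H₁ →L[ℂ] H₁)) T₂) :
    CompletelyDominatedWithBound (‖(↑L⁻¹ : H₁ →L[ℂ] H₁)‖ * ‖(L : H₁ →L[ℂ] H₁)‖) T₁ T₂ :=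
  fun n hn p => (norm_polyMatrix_le_of_similar L p).trans (by gcongr; exact h n hn p)

omit [CompleteSpace H₁] [CompleteSpace H₂] in
theorem CompletelyDominatedWithBound.mono {M' : ℝ} (h : CompletelyDominatedWithBound M T₁ T₂)
    (hM : M ≤ M') : CompletelyDominatedWithBound M' T₁ T₂ :=
  fun n hn p => (h n hn p).trans (by gcongr)

omit [CompleteSpace H₁] [CompleteSpace H₂] in
theorem bddBelow_dominanceBounds (T₁ : H₁ →L[ℂ] H₁) (T₂ : H₂ →L[ℂ] H₂) :
    BddBelow {M : ℝ | 0 < M ∧ CompletelyDominatedWithBound M T₁ T₂} :=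
  ⟨0, fun _ hM => hM.1.le⟩

omit [CompleteSpace H₁] [CompleteSpace H₂] in
/-- The infimum of the bounds is attained, since the inequality is closed in the bound. -/
theorem CompletelyDominatedFiniteBound.withBound_least
    (h : CompletelyDominatedFiniteBound T₁ T₂) :
    CompletelyDominatedWithBound (leastDominanceBound T₁ T₂) T₁ T₂ := by
  intro n hn p
  rcases (norm_nonneg (polyMatrix p T₂)).eq_or_lt with h0 | h0
  · obtain ⟨M, -, hM⟩ := h
    simpa [← h0] using hM n hn p
  · rw [← div_le_iff₀ h0]
    exact le_csInf h fun M hM => (div_le_iff₀ h0).2 (hM.2 n hn p)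

theorem CompletelyDominatedFiniteBound.similarityConstant_eq
    (h : CompletelyDominatedFiniteBound T₁ T₂) :
    similarityConstant T₁ (cDom H₁ T₂) = leastDominanceBound T₁ T₂ := by
  have hbdd : BddBelow {c : ℝ | ∃ L : (H₁ →L[ℂ] H₁)ˣ,
      (↑L⁻¹ : H₁ →L[ℂ] H₁) * T₁ * (L : H₁ →L[ℂ] H₁) ∈ cDom H₁ T₂ ∧
        c = ‖(↑L⁻¹ : H₁ →L[ℂ] H₁)‖ * ‖(L : H₁ →L[ℂ] H₁)‖} :=
    ⟨0, by rintro _ ⟨L, -, rfl⟩; positivity⟩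
  apply le_antisymm
  · refine le_csInf h fun M hM => ?_
    obtain ⟨L, hL, hLM⟩ := hM.2.exists_similar hM.1.le
    exact (csInf_le hbdd ⟨L, hL, rfl⟩).trans hLM
  · obtain ⟨M, hM, hMb⟩ := h
    obtain ⟨L, hL, -⟩ := hMb.exists_similar hM.le
    refine le_csInf ⟨_, L, hL, rfl⟩ ?_
    rintro _ ⟨L, hL, rfl⟩
    -- On `H₁ = 0` the product of norms is zero, hence is not itself among the positive bounds.
    refine le_of_forall_pos_le_add fun ε hε => csInf_le (bddBelow_dominanceBounds T₁ T₂)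
      ⟨by positivity, (CompletelyDominated.withBound_of_similar L hL).mono (by linarith)⟩

end Dominance

end PolyDominated

theorem theorem2p2 {H₁ : Type u} {H₂ : Type v}
    [NormedAddCommGroup H₁] [InnerProductSpace ℂ H₁] [CompleteSpace H₁]
    [NormedAddCommGroup H₂] [InnerProductSpace ℂ H₂] [CompleteSpace H₂]
    (T₁ : H₁ →L[ℂ] H₁) (T₂ : H₂ →L[ℂ] H₂) :
    (PolyDominated.CompletelyDominated T₁ T₂ ↔
      ∃ (K : Type (max u v w)) (_ : NormedAddCommGroup K) (_ : InnerProductSpace ℂ K)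
        (_ : CompleteSpace K) (π : (H₂ →L[ℂ] H₂) →⋆ₐ[ℂ] (K →L[ℂ] K))
        (M : Submodule ℂ K) (_ : M.HasOrthogonalProjection),
        PolyDominated.IsSemiInvariant (π T₂) M ∧
          PolyDominated.UnitarilyEquivalent T₁ (PolyDominated.compression M (π T₂))) ∧
    (PolyDominated.CompletelyDominatedFiniteBound T₁ T₂ ↔
      ∃ S : H₁ →L[ℂ] H₁, PolyDominated.Similar T₁ S ∧ PolyDominated.CompletelyDominated S T₂) ∧
    (PolyDominated.CompletelyDominatedFiniteBound T₁ T₂ →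
      PolyDominated.similarityConstant T₁ (PolyDominated.cDom H₁ T₂) =
          PolyDominated.leastDominanceBound T₁ T₂ ∧
        PolyDominated.CompletelyDominatedWithBound (PolyDominated.leastDominanceBound T₁ T₂)
          T₁ T₂) := by
  refine ⟨⟨fun h => ?_, ?_⟩, ⟨?_, ?_⟩, fun h => ⟨h.similarityConstant_eq, h.withBound_least⟩⟩
  · have h1 : PolyDominated.CompletelyDominatedWithBound 1 T₁ T₂ := fun n hn p =>
      (h n hn p).trans_eq (one_mul _).symm
    obtain ⟨K, _, _, _, π, E, hE, S, hsemi, hS, hS₁, hS₂⟩ :=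
      PolyDominated.CompletelyDominatedWithBound.exists_compression.{u, v, w} zero_le_one h1
    simp only [Real.sqrt_one, one_mul] at hS₁ hS₂
    -- With bound `1` the similarity and its inverse are contractions, so that it is unitary.
    refine ⟨K, inferInstance, inferInstance, inferInstance, π, E, hE, hsemi,
      PolyDominated.UnitarilyEquivalent.symm ⟨⟨S.toLinearEquiv, fun x => ?_⟩, hS⟩⟩
    exact le_antisymm (hS₁ x) (by simpa using hS₂ (S x))
  · rintro ⟨K, _, _, _, π, E, hE, hsemi, hU⟩
    exact PolyDominated.completelyDominated_of_compression π E hsemi hU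
  · rintro ⟨M, hM, h⟩
    obtain ⟨L, hL, -⟩ := h.exists_similar hM.le
    exact ⟨_, ⟨L, rfl⟩, hL⟩
  · rintro ⟨_, ⟨L, rfl⟩, hL⟩
    exact ⟨_, by positivity, (PolyDominated.CompletelyDominated.withBound_of_similar L hL).mono
      (le_add_of_nonneg_right zero_le_one)⟩
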